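/- For a finite group $G$ let $\rho(G)=\prod_{g\in G}o(g)$ be the product of the orders of its elements, and let $\operatorname{Exp}_\rho(G)=\{\alpha_1,\dots,\alpha_k\}$ be the set (without multiplicities) of exponents in the prime factorization $\rho(G)=p_1^{\alpha_1}\cdots p_k^{\alpha_k}$, where $p_1,\dots,p_k$ are the distinct prime divisors of $\rho(G)$. Write $\mathbb{Z}_n$ for the cyclic group of order $n$. **Theorem.** Let $G$ be a finite group and let $q$ and $r$ be distinct odd prime numbers. Then $$\operatorname{Exp}_\rho(\mathbb{Z}_{2qr})=\{qr,\;2r(q-1),\;2q(r-1)\},$$ and $\operatorname{Exp}_\rho(G)=\operatorname{Exp}_\rho(\mathbb{Z}_{2qr})$ if and only if $G\cong\mathbb{Z}_{2qr}$, or $\{q,r\}=\{3,5\}$ and $G\cong\mathrm{PSL}(2,5)$. -/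

import Mathlib

/-- The product of the element orders of a finite group `G`. -/
noncomputable def rho (G : Type*) [Group G] : ℕ := ∏ᶠ g : G, orderOf g

/-- The set of exponents in the prime factorization of `n`. -/
def expSet (n : ℕ) : Finset ℕ := n.primeFactors.image n.factorization

/-- The set of exponents in the prime factorization of the product of the element orders of `G`. -/
noncomputable def expRho (G : Type*) [Group G] : Finset ℕ := expSet (rho G)

/-!
By a theorem of Frobenius, the number of elements of `G` whose `p`-part lies in a given conjugacy
class of `p`-elements is a multiple of the `p'`-part of `|G|`. So the exponent of `p` in `ρ(G)` is a
multiple of that `p'`-part, and the two agree only if all nontrivial `p`-elements are conjugate. For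
odd `p` the exponent is even; hence if the exponents of `ρ(G)` are `qr`, `2r(q - 1)` and
`2q(r - 1)`, then `qr` is the exponent of `2`, which leaves `|G| = 2 ^ f * q * r` with a single
class of nontrivial `2`-elements, all of them involutions.

A Sylow `p`-subgroup `P` of prime order contributes the exponent `|G| (p - 1) / (p |A|)`, where
`A = N(P) / C(P)`. For `p = q` and `p = r` this gives `2 |A| = 2 ^ f`, and since `A` acts faithfully
on a group of prime order, it is cyclic; as `2`-elements have order at most `2`, `|A| ≤ 2`. If
`|A| = 1`, Burnside's transfer theorem makes `G` abelian, hence cyclic. If `|A| = 2`, then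
`|G| = 4qr`, and conjugacy of the involutions forces an automorphism of order `3` on the Sylow
`2`-subgroups, so that `3 ∈ {q, r}`. Sylow's theorem then gives `5` for the other prime, and the
conjugation action on the five Sylow `2`-subgroups embeds `G` in `S₅` with index `2`. The group
`PSL(2, 5)`, whose element orders are determined by the trace, has the exponents of this case and is
not cyclic, so it is `A₅` too.
-/

section Counting

lemma factorization_pow_mul_of_not_dvd {p m : ℕ} [hp : Fact p.Prime] (k : ℕ) (hm : ¬ p ∣ m) :
    (p ^ k * m).factorization p = k := by
  have hm0 : m ≠ 0 := fun h => hm (h.symm ▸ dvd_zero p)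
  rw [Nat.factorization_mul (pow_ne_zero k hp.out.ne_zero) hm0,
    Finsupp.add_apply, Nat.factorization_eq_zero_of_not_dvd hm, add_zero,
    hp.out.factorization_pow, Finsupp.single_eq_same]

lemma card_eq_card_mul_of_card_fiber_eq {α β : Type*} [Finite α] [Finite β] (f : α → β) {k : ℕ}
    (h : ∀ b, Nat.card {a // f a = b} = k) : Nat.card α = Nat.card β * k := by
  have := Fintype.ofFinite β
  rw [← Nat.card_congr (Equiv.sigmaFiberEquiv f), Nat.card_sigma, Nat.card_eq_fintype_card]
  exact Finset.sum_const_nat fun b _ => h b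

lemma prod_orderOf_quotient_mk {G : Type*} [Group G] [Fintype G] (N : Subgroup G) [N.Normal] :
    ∏ g : G, orderOf (g : G ⧸ N) = rho (G ⧸ N) ^ Nat.card N := by
  classical
  have := Fintype.ofFinite (G ⧸ N)
  have hfiber (x : G ⧸ N) :
      (Finset.univ.filter fun g : G => (g : G ⧸ N) = x).card = Nat.card N := by
    have hcard := QuotientGroup.card_preimage_mk N {x}
    rw [Nat.card_unique (α := ({x} : Set _)), mul_one] at hcard
    rw [← Fintype.card_subtype, ← Nat.card_eq_fintype_card]
    exact hcard
  rw [rho, finprod_eq_prod_of_fintype, ← Finset.prod_pow,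
    ← Finset.prod_fiberwise Finset.univ ((↑) : G → G ⧸ N)]
  refine Finset.prod_congr rfl fun x _ => ?_
  rw [← hfiber x]
  exact Finset.prod_eq_pow_card fun g hg => by rw [(Finset.mem_filter.1 hg).2]

end Counting

section PPart

/-- A `p`-element of a group: an element whose order is a power of `p`. -/
def IsPElement (p : ℕ) {G : Type*} [Group G] (g : G) : Prop := ∃ k, g ^ p ^ k = 1

/-- An exponent congruent to `1` modulo the `p`-part of `n` and divisible by the `p'`-part of `n`,
so that raising to this power extracts the `p`-part of an element of order dividing `n`. The
congruence is Euler's theorem. -/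
def pPartExponent (p n : ℕ) : ℕ := (ordCompl[p] n) ^ Nat.totient (ordProj[p] n)

/-- The `p`-part of an element `g` of a finite group: the power of `g` that is a `p`-element and
differs from `g` by an element of order prime to `p`. -/
noncomputable def pPart (p : ℕ) {G : Type*} [Group G] (g : G) : G :=
  g ^ pPartExponent p (Nat.card G)

/-- The `p`-regular elements of a finite group, those of order prime to `p`. -/
def pRegular (p : ℕ) (G : Type*) [Group G] : Set G := {g | ¬ p ∣ orderOf g}

variable {G : Type*} [Group G] {p : ℕ}

lemma IsPElement.isPGroup_zpowers {g : G} (hg : IsPElement p g) :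
    IsPGroup p (Subgroup.zpowers g) := by
  obtain ⟨k, hk⟩ := hg
  rintro ⟨_, i, rfl⟩
  refine ⟨k, Subtype.ext ?_⟩
  change (g ^ i) ^ p ^ k = 1
  rw [← zpow_natCast, zpow_comm, zpow_natCast, hk, one_zpow]

lemma isPElement_of_mem_of_isPGroup {P : Subgroup G} (hP : IsPGroup p P) {g : G} (hg : g ∈ P) :
    IsPElement p g :=
  (hP ⟨g, hg⟩).imp fun _ h => congrArg Subtype.val h

lemma commute_pPart (g : G) : Commute (pPart p g) g := (Commute.refl g).pow_left _

lemma pPart_mul {g h : G} (hgh : Commute g h) : pPart p (g * h) = pPart p g * pPart p h :=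
  hgh.mul_pow _

lemma pPart_conj (c g : G) : pPart p (c * g * c⁻¹) = c * pPart p g * c⁻¹ := conj_pow

variable [hp : Fact p.Prime]

lemma pPartExponent_modEq_one {n : ℕ} (hn : n ≠ 0) : pPartExponent p n ≡ 1 [MOD ordProj[p] n] :=
  Nat.ModEq.pow_totient ((Nat.coprime_ordCompl hp.out hn).symm.pow_right _)

lemma ordCompl_dvd_pPartExponent (n : ℕ) : ordCompl[p] n ∣ pPartExponent p n :=
  dvd_pow_self _ (Nat.totient_pos.2 (pow_pos hp.out.pos _)).ne'

lemma pow_pPartExponent_eq_one_iff {n : ℕ} (hn : n ≠ 0) {g : G} (hg : orderOf g ∣ n) :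
    g ^ pPartExponent p n = 1 ↔ ¬ p ∣ orderOf g := by
  rw [← orderOf_dvd_iff_pow_eq_one]
  constructor
  · intro h hpg
    have hpn : p ∣ ordProj[p] n :=
      dvd_pow_self p (hp.out.factorization_pos_of_dvd hn (hpg.trans hg)).ne'
    have : p ∣ 1 := ((pPartExponent_modEq_one hn).of_dvd hpn).dvd_iff dvd_rfl |>.1 (hpg.trans h)
    exact hp.out.not_dvd_one this
  · intro h
    refine Nat.Coprime.dvd_of_dvd_mul_left ?_ ((Nat.ordProj_mul_ordCompl_eq_self n p).symm ▸ hg)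
      |>.trans (ordCompl_dvd_pPartExponent n)
    exact ((hp.out.coprime_iff_not_dvd.2 h).pow_left _).symm

lemma isPElement_iff_exists_orderOf_eq {g : G} : IsPElement p g ↔ ∃ k, orderOf g = p ^ k :=
  exists_orderOf_eq_prime_pow_iff.symm

lemma IsPElement.dvd_orderOf {g : G} (hg : IsPElement p g) (hg1 : g ≠ 1) : p ∣ orderOf g := by
  obtain ⟨k, hk⟩ := isPElement_iff_exists_orderOf_eq.1 hg
  rw [hk]
  refine dvd_pow_self p ?_
  rintro rfl
  exact hg1 (orderOf_eq_one_iff.1 hk)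

lemma isPElement_pPart (g : G) : IsPElement p (pPart p g) := by
  obtain ⟨m, hm⟩ := ordCompl_dvd_pPartExponent (p := p) (Nat.card G)
  refine ⟨(Nat.card G).factorization p, ?_⟩
  rw [pPart, ← pow_mul, hm, mul_right_comm, Nat.div_mul_cancel (Nat.ordProj_dvd _ _), pow_mul,
    pow_card_eq_one', one_pow]

variable [Finite G]

lemma pPart_eq_one_iff {g : G} : pPart p g = 1 ↔ g ∈ pRegular p G :=
  pow_pPartExponent_eq_one_iff Nat.card_pos.ne' (orderOf_dvd_natCard g)

lemma IsPElement.pPart_eq {g : G} (hg : IsPElement p g) : pPart p g = g := by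
  obtain ⟨k, hk⟩ := isPElement_iff_exists_orderOf_eq.1 hg
  have hdvd : orderOf g ∣ ordProj[p] (Nat.card G) := by
    rw [hk]
    exact pow_dvd_pow p ((hp.out.pow_dvd_iff_le_factorization Nat.card_pos.ne').1
      (hk ▸ orderOf_dvd_natCard g))
  exact (pow_eq_pow_iff_modEq.2 ((pPartExponent_modEq_one Nat.card_pos.ne').of_dvd hdvd)).trans
    (pow_one g)

lemma pPart_inv_mul_mem_pRegular (g : G) : (pPart p g)⁻¹ * g ∈ pRegular p G := by
  have hinv : pPart p (pPart p g)⁻¹ = (pPart p (pPart p g))⁻¹ := inv_pow _ _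
  rw [← pPart_eq_one_iff, pPart_mul (commute_pPart g).inv_left, hinv, (isPElement_pPart g).pPart_eq,
    inv_mul_cancel]

lemma factorization_orderOf_pPart (g : G) :
    (orderOf (pPart p g)).factorization p = (orderOf g).factorization p := by
  obtain ⟨k, hk⟩ := isPElement_iff_exists_orderOf_eq.1 (isPElement_pPart (p := p) g)
  have hreg : ¬ p ∣ orderOf ((pPart p g)⁻¹ * g) := pPart_inv_mul_mem_pRegular g
  have hcomm : Commute (pPart p g) ((pPart p g)⁻¹ * g) :=
    (Commute.refl _).inv_right.mul_right (commute_pPart g)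
  have horder := hcomm.orderOf_mul_eq_mul_orderOf_of_coprime
    (by rw [hk]; exact (hp.out.coprime_iff_not_dvd.2 hreg).pow_left _)
  rw [mul_inv_cancel_left] at horder
  rw [horder, Nat.factorization_mul (orderOf_pos _).ne' (orderOf_pos _).ne', Finsupp.add_apply,
    Nat.factorization_eq_zero_of_not_dvd hreg, add_zero]

lemma factorization_orderOf_of_isConj_pPart {y g : G} (h : IsConj y (pPart p g)) :
    (orderOf g).factorization p = (orderOf y).factorization p := by
  obtain ⟨c, hc⟩ := isConj_iff.1 h
  rw [← factorization_orderOf_pPart, ← hc]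
  exact congrArg (fun n => n.factorization p) ((MulAut.conj c).orderOf_eq y)

end PPart

section FrobeniusCount

/-- The `p`-section of a conjugacy class `c` in Brauer's sense: the elements whose `p`-part lies
in `c`. -/
def pSection (p : ℕ) {G : Type*} [Group G] (c : ConjClasses G) : Set G :=
  {g | ConjClasses.mk (pPart p g) = c}

variable {G : Type*} [Group G] {p : ℕ}

lemma sum_card_pSection [Finite G] [Fintype (ConjClasses G)] :
    ∑ c : ConjClasses G, Nat.card (pSection p c) = Nat.card G := by
  rw [← Nat.card_sigma]
  exact Nat.card_congr (Equiv.sigmaFiberEquiv _)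

lemma card_carrier_mul_card_centralizer (y : G) :
    Nat.card (ConjClasses.mk y).carrier * Nat.card (Subgroup.centralizer ({y} : Set G)) =
      Nat.card G := by
  have h := (MulAction.stabilizer (ConjAct G) y).card_mul_index
  rw [MulAction.index_stabilizer, ConjAct.orbit_eq_carrier_conjClasses,
    ← Subgroup.nat_card_centralizer_nat_card_stabilizer, mul_comm] at h
  rw [← Nat.card_congr (ConjAct.ofConjAct (G := G)).toEquiv, ← h, Nat.card_coe_set_eq]

lemma normal_of_le_center {Z : Subgroup G} (hc : Z ≤ Subgroup.center G) : Z.Normal :=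
  ⟨fun z hz g => by rwa [Subgroup.mem_center_iff.1 (hc hz) g, mul_inv_cancel_right]⟩

lemma card_pPart_fiber_conj (c y : G) :
    Nat.card {g : G // pPart p g = c * y * c⁻¹} = Nat.card {g : G // pPart p g = y} := by
  refine (Nat.card_congr ((MulAut.conj c).toEquiv.subtypeEquiv fun g => ?_)).symm
  change pPart p g = y ↔ pPart p (c * g * c⁻¹) = c * y * c⁻¹
  rw [pPart_conj, mul_left_inj, mul_right_inj]

lemma zpowers_le_center_centralizer (y : G) :
    Subgroup.zpowers (⟨y, Subgroup.mem_centralizer_singleton_iff.2 rfl⟩ :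
      Subgroup.centralizer ({y} : Set G)) ≤ Subgroup.center _ := by
  rw [Subgroup.zpowers_le, Subgroup.mem_center_iff]
  rintro ⟨g, hg⟩
  exact Subtype.ext (Subgroup.mem_centralizer_singleton_iff.1 hg)

variable [hp : Fact p.Prime] [Finite G]

lemma card_pPart_fiber {y : G} (hy : IsPElement p y) :
    Nat.card {g : G // pPart p g = y} =
      Nat.card (pRegular p (Subgroup.centralizer ({y} : Set G))) := by
  refine Nat.card_congr ⟨fun g => ⟨⟨y⁻¹ * g.1, ?_⟩, ?_⟩, fun z => ⟨y * z.1.1, ?_⟩, ?_, ?_⟩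
  · have hcomm : Commute (pPart p g.1) g.1 := commute_pPart g.1
    rw [g.2] at hcomm
    exact Subgroup.mem_centralizer_singleton_iff.2
      ((Commute.refl y).inv_left.mul_left hcomm.symm).eq
  · have hreg : ¬ p ∣ orderOf ((pPart p g.1)⁻¹ * g.1) := pPart_inv_mul_mem_pRegular g.1
    rw [g.2, ← Subgroup.orderOf_mk] at hreg
    exact hreg
  · have hcomm : Commute y z.1.1 := (Subgroup.mem_centralizer_singleton_iff.1 z.1.2).symm
    have hreg : z.1.1 ∈ pRegular p G := fun h => z.2 (Subgroup.orderOf_coe z.1 ▸ h)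
    rw [pPart_mul hcomm, hy.pPart_eq, pPart_eq_one_iff.2 hreg, mul_one]
  · intro g; simp
  · intro z; simp

lemma card_pSection_mk {y : G} (hy : IsPElement p y) :
    Nat.card (pSection p (ConjClasses.mk y)) = Nat.card (ConjClasses.mk y).carrier *
      Nat.card (pRegular p (Subgroup.centralizer ({y} : Set G))) := by
  refine card_eq_card_mul_of_card_fiber_eq (fun g => ⟨pPart p g.1,
    ConjClasses.mem_carrier_iff_mk_eq.2 g.2⟩) fun ⟨x, hx⟩ => ?_
  obtain ⟨c, rfl⟩ := isConj_iff.1 (ConjClasses.mk_eq_mk_iff_isConj.1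
    (ConjClasses.mem_carrier_iff_mk_eq.1 hx).symm)
  rw [← card_pPart_fiber hy, ← card_pPart_fiber_conj c y]
  refine Nat.card_congr ⟨fun g => ⟨g.1.1, congrArg Subtype.val g.2⟩,
    fun g => ⟨⟨g.1, ?_⟩, Subtype.ext g.2⟩, fun _ => rfl, fun _ => rfl⟩
  exact (congrArg ConjClasses.mk g.2).trans (ConjClasses.mem_carrier_iff_mk_eq.1 hx)

lemma pSection_mk_one : pSection p (ConjClasses.mk (1 : G)) = pRegular p G := by
  ext g
  rw [← pPart_eq_one_iff, ← isConj_one_left, ← ConjClasses.mk_eq_mk_iff_isConj]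
  rfl

lemma card_pRegular_quotient {Z : Subgroup G} [Z.Normal] (hZ : IsPGroup p Z)
    (hc : Z ≤ Subgroup.center G) :
    Nat.card (pRegular p (G ⧸ Z)) = Nat.card (pRegular p G) := by
  symm
  refine Nat.card_congr (Equiv.ofBijective (fun z => ⟨QuotientGroup.mk z.1, fun h =>
    z.2 (h.trans (orderOf_map_dvd (QuotientGroup.mk' Z) z.1))⟩) ⟨?_, ?_⟩)
  · rintro ⟨z, hz⟩ ⟨w, hw⟩ h
    have hzw : z⁻¹ * w ∈ Z := QuotientGroup.eq.1 (congrArg Subtype.val h)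
    have hcomm : Commute z (z⁻¹ * w) := Subgroup.mem_center_iff.1 (hc hzw) z
    have hpart : pPart p w = z⁻¹ * w := by
      rw [← (isPElement_of_mem_of_isPGroup hZ hzw).pPart_eq]
      conv_lhs => rw [← mul_inv_cancel_left z w]
      rw [pPart_mul hcomm, pPart_eq_one_iff.2 hz, one_mul]
    rw [pPart_eq_one_iff.2 hw, eq_comm, inv_mul_eq_one] at hpart
    exact Subtype.ext hpart
  · rintro ⟨x, hx⟩
    obtain ⟨g, rfl⟩ := QuotientGroup.mk_surjective x
    refine ⟨⟨_, pPart_inv_mul_mem_pRegular g⟩, Subtype.ext ?_⟩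
    have hg : orderOf (g : G ⧸ Z) ∣ Nat.card G :=
      (orderOf_map_dvd (QuotientGroup.mk' Z) g).trans (orderOf_dvd_natCard g)
    have hpart : ((pPart p g : G) : G ⧸ Z) = 1 := by
      rw [pPart, QuotientGroup.mk_pow, pow_pPartExponent_eq_one_iff Nat.card_pos.ne' hg]
      exact hx
    change (((pPart p g)⁻¹ * g : G) : G ⧸ Z) = g
    rw [QuotientGroup.mk_mul, QuotientGroup.mk_inv, hpart, inv_one, one_mul]

lemma card_mul_card_pRegular_of_not_dvd_index {Z : Subgroup G} (hZ : IsPGroup p Z)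
    (hc : Z ≤ Subgroup.center G) (hi : ¬ p ∣ Z.index) :
    Nat.card Z * Nat.card (pRegular p G) = Nat.card G := by
  have : Z.Normal := normal_of_le_center hc
  have huniv : pRegular p (G ⧸ Z) = Set.univ :=
    Set.eq_univ_of_forall fun x h => hi (h.trans (orderOf_dvd_natCard x))
  rw [← card_pRegular_quotient hZ hc, huniv, Nat.card_univ, ← Z.card_mul_index, Subgroup.index]

lemma ordCompl_dvd_card_pRegular_of_quotient {Z : Subgroup G} [Z.Normal] (hZ : IsPGroup p Z)
    (hc : Z ≤ Subgroup.center G)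
    (h : ordCompl[p] (Nat.card (G ⧸ Z)) ∣ Nat.card (pRegular p (G ⧸ Z))) :
    ordCompl[p] (Nat.card G) ∣ Nat.card (pRegular p G) := by
  obtain ⟨k, hk⟩ := IsPGroup.iff_card.1 hZ
  rwa [Z.card_eq_card_quotient_mul_card_subgroup, Nat.ordCompl_mul, hk, hp.out.factorization_pow,
    Finsupp.single_eq_same, Nat.div_self (pow_pos hp.out.pos _), mul_one,
    ← card_pRegular_quotient hZ hc]

lemma ordCompl_dvd_card_pSection_of_forall_centralizer {c : ConjClasses G}
    (h : ∀ y : G, IsPElement p y → ConjClasses.mk y = c →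
      ordCompl[p] (Nat.card (Subgroup.centralizer ({y} : Set G))) ∣
        Nat.card (pRegular p (Subgroup.centralizer ({y} : Set G)))) :
    ordCompl[p] (Nat.card G) ∣ Nat.card (pSection p c) := by
  rcases (pSection p c).eq_empty_or_nonempty with hempty | ⟨g, rfl⟩
  · simp [hempty]
  · have hy : IsPElement p (pPart p g) := isPElement_pPart g
    rw [card_pSection_mk hy, ← card_carrier_mul_card_centralizer (pPart p g), Nat.ordCompl_mul]
    exact mul_dvd_mul (Nat.ordCompl_dvd _ _) (h _ hy rfl)

lemma ordCompl_dvd_card_pRegular : ordCompl[p] (Nat.card G) ∣ Nat.card (pRegular p G) := by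
  induction hn : Nat.card G using Nat.strong_induction_on generalizing G with
  | _ n ih =>
    subst hn
    classical
    have := Fintype.ofFinite (ConjClasses G)
    have hsum : ordCompl[p] (Nat.card G) ∣
        Nat.card (pSection p (ConjClasses.mk (1 : G))) +
          ∑ c ∈ Finset.univ.erase (ConjClasses.mk (1 : G)), Nat.card (pSection p c) := by
      rw [Finset.add_sum_erase _ (fun c => Nat.card (pSection p c)) (Finset.mem_univ _),
        sum_card_pSection]
      exact Nat.ordCompl_dvd _ _
    rw [pSection_mk_one] at hsum
    refine (Nat.dvd_add_left (Finset.dvd_sum fun c hc => ?_)).1 hsum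
    refine ordCompl_dvd_card_pSection_of_forall_centralizer fun y hy hyc => ?_
    have hy1 : y ≠ 1 := by
      rintro rfl
      exact Finset.ne_of_mem_erase hc hyc.symm
    set y' : Subgroup.centralizer ({y} : Set G) :=
      ⟨y, Subgroup.mem_centralizer_singleton_iff.2 rfl⟩
    have hZ : IsPGroup p (Subgroup.zpowers y') :=
      IsPElement.isPGroup_zpowers (hy.imp fun _ h => Subtype.ext h)
    have hc := zpowers_le_center_centralizer y
    have : (Subgroup.zpowers y').Normal := normal_of_le_center hc
    refine ordCompl_dvd_card_pRegular_of_quotient hZ hc (ih _ ?_ rfl)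
    have hZ1 : Subgroup.zpowers y' ≠ ⊥ := fun h =>
      hy1 (congrArg Subtype.val (Subgroup.zpowers_eq_bot.1 h))
    calc Nat.card (_ ⧸ Subgroup.zpowers y') < Nat.card (Subgroup.centralizer ({y} : Set G)) := by
          rw [(Subgroup.zpowers y').card_eq_card_quotient_mul_card_subgroup]
          exact lt_mul_of_one_lt_right Nat.card_pos (Subgroup.one_lt_card_iff_ne_bot _ |>.2 hZ1)
      _ ≤ Nat.card G := Subgroup.card_le_card_group _

theorem ordCompl_dvd_card_pSection (c : ConjClasses G) :
    ordCompl[p] (Nat.card G) ∣ Nat.card (pSection p c) :=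
  ordCompl_dvd_card_pSection_of_forall_centralizer fun _ _ _ => ordCompl_dvd_card_pRegular

end FrobeniusCount

section Rho

variable {G : Type*} [Group G]

lemma rho_congr {H : Type*} [Group H] (e : G ≃* H) : rho G = rho H :=
  finprod_eq_of_bijective e e.bijective fun g => (e.orderOf_eq g).symm

variable [Finite G]

lemma rho_ne_zero : rho G ≠ 0 := by
  have := Fintype.ofFinite G
  rw [rho, finprod_eq_prod_of_fintype]
  exact Finset.prod_ne_zero_iff.2 fun g _ => (orderOf_pos g).ne'

lemma primeFactors_rho : (rho G).primeFactors = (Nat.card G).primeFactors := by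
  have := Fintype.ofFinite G
  ext p
  simp only [Nat.mem_primeFactors_of_ne_zero rho_ne_zero,
    Nat.mem_primeFactors_of_ne_zero Nat.card_pos.ne', and_congr_right_iff]
  intro hp
  rw [rho, finprod_eq_prod_of_fintype]
  refine ⟨fun h => ?_, fun h => h.trans (Group.card_dvd_prod_orderOf G)⟩
  obtain ⟨g, -, hg⟩ := (hp.prime.dvd_finsetProd_iff _).1 h
  exact hg.trans (orderOf_dvd_natCard g)

lemma expRho_eq_image : expRho G = (Nat.card G).primeFactors.image (rho G).factorization := by
  rw [expRho, expSet, primeFactors_rho]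

lemma factorization_rho [Fintype G] (p : ℕ) :
    (rho G).factorization p = ∑ g : G, (orderOf g).factorization p := by
  rw [rho, finprod_eq_prod_of_fintype, Nat.factorization_prod fun g _ => (orderOf_pos g).ne',
    Finsupp.finsetSum_apply]

lemma even_factorization_rho {p : ℕ} (hp : p ≠ 2) : Even ((rho G).factorization p) := by
  have := Fintype.ofFinite G
  rw [even_iff_two_dvd, ← ZMod.natCast_eq_zero_iff, factorization_rho, Nat.cast_sum]
  refine Finset.sum_involution (fun g _ => g⁻¹) (fun g _ => ?_) (fun g _ h hg => h ?_)
    (fun _ _ => Finset.mem_univ _) (fun g _ => inv_inv g)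
  · rw [orderOf_inv]
    exact CharTwo.add_self_eq_zero _
  · have hdvd : orderOf g ∣ 2 :=
      orderOf_dvd_of_pow_eq_one (by rw [pow_two, ← inv_eq_iff_mul_eq_one, hg])
    rcases (Nat.dvd_prime Nat.prime_two).1 hdvd with h1 | h2
    · simp [h1]
    · simp [h2, Nat.prime_two.factorization, hp.symm]

variable {p : ℕ} [hp : Fact p.Prime]

lemma factorization_rho_eq_sum_pSection [Fintype (ConjClasses G)] :
    (rho G).factorization p =
      ∑ c : ConjClasses G, Nat.card (pSection p c) * (orderOf c.out).factorization p := by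
  classical
  have := Fintype.ofFinite G
  rw [factorization_rho, ← Finset.sum_fiberwise _ fun g => ConjClasses.mk (pPart p g)]
  refine Finset.sum_congr rfl fun c _ => ?_
  have hcard : Nat.card (pSection p c) =
      (Finset.univ.filter fun g : G => ConjClasses.mk (pPart p g) = c).card := by
    rw [← Fintype.card_subtype, ← Nat.card_eq_fintype_card]
    rfl
  rw [hcard]
  refine Finset.sum_const_nat fun g hg => factorization_orderOf_of_isConj_pPart ?_
  rw [← ConjClasses.mk_eq_mk_iff_isConj, (Finset.mem_filter.1 hg).2]
  exact Quotient.out_eq c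

theorem ordCompl_dvd_factorization_rho :
    ordCompl[p] (Nat.card G) ∣ (rho G).factorization p := by
  have := Fintype.ofFinite (ConjClasses G)
  rw [factorization_rho_eq_sum_pSection]
  exact Finset.dvd_sum fun c _ => (ordCompl_dvd_card_pSection c).mul_right _

lemma factorization_rho_eq_card_of_not_sq_dvd (h : ∀ g : G, ¬ p ^ 2 ∣ orderOf g) :
    (rho G).factorization p = Nat.card {g : G // p ∣ orderOf g} := by
  classical
  have := Fintype.ofFinite G
  rw [factorization_rho, Nat.card_eq_fintype_card, Fintype.card_subtype, Finset.card_filter]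
  refine Finset.sum_congr rfl fun g _ => ?_
  have hg := (orderOf_pos g).ne'
  have hlt : (orderOf g).factorization p < 2 :=
    not_le.1 fun h2 => h g ((hp.out.pow_dvd_iff_le_factorization hg).2 h2)
  split_ifs with hd
  · exact le_antisymm (Nat.lt_succ_iff.1 hlt) (hp.out.factorization_pos_of_dvd hg hd)
  · exact Nat.factorization_eq_zero_of_not_dvd hd

end Rho

section UniquePClass

/-- A group has a *unique `p`-class* if its nontrivial `p`-elements form (at most) one conjugacy
class. This is how minimality of the exponent of `p` in `rho G` is exploited. -/
def HasUniquePClass (p : ℕ) (G : Type*) [Group G] : Prop :=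
  ∀ ⦃y z : G⦄, IsPElement p y → IsPElement p z → y ≠ 1 → z ≠ 1 → IsConj y z

variable {G : Type*} [Group G] [Finite G] {p : ℕ} [hp : Fact p.Prime]

lemma ordCompl_le_card_pSection_mul {y : G} (hy : IsPElement p y) (hy1 : y ≠ 1) :
    ordCompl[p] (Nat.card G) ≤ Nat.card (pSection p (ConjClasses.mk y)) *
      (orderOf (ConjClasses.mk y).out).factorization p := by
  have hout : IsConj (ConjClasses.mk y).out (pPart p y) := by
    rw [hy.pPart_eq, ← ConjClasses.mk_eq_mk_iff_isConj]
    exact Quotient.out_eq _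
  have : Nonempty (pSection p (ConjClasses.mk y)) :=
    ⟨⟨y, congrArg ConjClasses.mk hy.pPart_eq⟩⟩
  rw [← factorization_orderOf_of_isConj_pPart hout]
  exact (Nat.le_of_dvd Nat.card_pos (ordCompl_dvd_card_pSection _)).trans
    (Nat.le_mul_of_pos_right _
      (hp.out.factorization_pos_of_dvd (orderOf_pos y).ne' (hy.dvd_orderOf hy1)))

theorem hasUniquePClass_of_factorization_rho_eq
    (h : (rho G).factorization p = ordCompl[p] (Nat.card G)) : HasUniquePClass p G := by
  classical
  intro y z hy hz hy1 hz1
  have := Fintype.ofFinite (ConjClasses G)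
  by_contra hyz
  have hsum := Finset.sum_le_sum_of_subset (f := fun c : ConjClasses G =>
    Nat.card (pSection p c) * (orderOf c.out).factorization p)
    (Finset.subset_univ {ConjClasses.mk y, ConjClasses.mk z})
  rw [Finset.sum_pair (mt ConjClasses.mk_eq_mk_iff_isConj.1 hyz),
    ← factorization_rho_eq_sum_pSection, h] at hsum
  have hpos : 0 < ordCompl[p] (Nat.card G) := Nat.ordCompl_pos p Nat.card_pos.ne'
  linarith [ordCompl_le_card_pSection_mul hy hy1, ordCompl_le_card_pSection_mul hz hz1]

lemma exists_mem_pow_eq_one_ne_one_of_dvd_card {K : Subgroup G} (hK : p ∣ Nat.card K) :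
    ∃ x ∈ K, x ^ p = 1 ∧ x ≠ 1 := by
  obtain ⟨x, hx⟩ := exists_prime_orderOf_dvd_card' p hK
  rw [← Subgroup.orderOf_coe] at hx
  refine ⟨x, x.2, hx ▸ pow_orderOf_eq_one (x : G), fun hx1 => hp.out.one_lt.ne ?_⟩
  rw [← hx, hx1, orderOf_one]

namespace HasUniquePClass

variable (h : HasUniquePClass p G) {y : G} (hy : IsPElement p y)

include h hy

lemma pow_eq_one : y ^ p = 1 := by
  by_cases hy1 : y = 1
  · rw [hy1, one_pow]
  have hcard : p ∣ Nat.card (Subgroup.zpowers y) := by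
    rw [Nat.card_zpowers]
    exact hy.dvd_orderOf hy1
  obtain ⟨x, -, hxp, hx1⟩ := exists_mem_pow_eq_one_ne_one_of_dvd_card hcard
  obtain ⟨c, rfl⟩ := isConj_iff.1 (h ⟨1, by rwa [pow_one]⟩ hy hx1 hy1)
  rw [conj_pow, hxp, mul_one, mul_inv_cancel]

lemma mem_of_dvd_card {K : Subgroup G} [hn : K.Normal] (hK : p ∣ Nat.card K) : y ∈ K := by
  by_cases hy1 : y = 1
  · exact hy1 ▸ K.one_mem
  obtain ⟨x, hxK, hxp, hx1⟩ := exists_mem_pow_eq_one_ne_one_of_dvd_card hK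
  obtain ⟨c, rfl⟩ := isConj_iff.1 (h ⟨1, by rwa [pow_one]⟩ hy hx1 hy1)
  exact hn.conj_mem x hxK c

end HasUniquePClass

variable (h : HasUniquePClass p G)

include h

lemma HasUniquePClass.sylow_le {K : Subgroup G} [K.Normal] (hK : p ∣ Nat.card K) (P : Sylow p G) :
    (P : Subgroup G) ≤ K :=
  fun _ hy => h.mem_of_dvd_card (isPElement_of_mem_of_isPGroup P.isPGroup' hy) hK

end UniquePClass

section Automizer

variable {G : Type*} [Group G]

/-- The automizer of a subgroup `P`: the automorphisms of `P` induced by its normalizer, a group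
isomorphic to `N(P) / C(P)`. -/
def automizer (P : Subgroup G) : Subgroup (MulAut P) := P.normalizerMonoidHom.range

lemma card_automizer_mul_card_centralizer (P : Subgroup G) :
    Nat.card (automizer P) * Nat.card (Subgroup.centralizer (P : Set G)) =
      Nat.card (Subgroup.normalizer (P : Set G)) := by
  rw [← P.normalizerMonoidHom.ker.index_mul_card, Subgroup.index_ker,
    Subgroup.normalizerMonoidHom_ker, automizer,
    Nat.card_congr (Subgroup.subgroupOfEquivOfLe (Subgroup.centralizer_le_normalizer _)).toEquiv]

lemma card_automizer_eq_one_iff {P : Subgroup G} :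
    Nat.card (automizer P) = 1 ↔
      Subgroup.normalizer (P : Set G) ≤ Subgroup.centralizer (P : Set G) := by
  rw [Subgroup.card_eq_one, automizer, MonoidHom.range_eq_bot_iff, ← MonoidHom.ker_eq_top_iff,
    Subgroup.normalizerMonoidHom_ker, Subgroup.subgroupOf_eq_top]

lemma card_centralizer_eq_of_isConj [Finite G] {y z : G} (h : IsConj y z) :
    Nat.card (Subgroup.centralizer ({y} : Set G)) =
      Nat.card (Subgroup.centralizer ({z} : Set G)) := by
  have hmk : ConjClasses.mk y = ConjClasses.mk z := ConjClasses.mk_eq_mk_iff_isConj.2 h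
  have hyz := (card_carrier_mul_card_centralizer y).trans
    (card_carrier_mul_card_centralizer z).symm
  have : Nonempty (ConjClasses.mk z).carrier := ⟨⟨z, ConjClasses.mem_carrier_mk⟩⟩
  rw [hmk] at hyz
  exact Nat.eq_of_mul_eq_mul_left Nat.card_pos hyz

variable {p : ℕ} [hp : Fact p.Prime]

lemma IsPElement.exists_mem_sylow_isConj [Finite G] (P : Sylow p G) {y : G} (hy : IsPElement p y) :
    ∃ z ∈ P, IsConj y z := by
  obtain ⟨Q, hQ⟩ := hy.isPGroup_zpowers.exists_le_sylow
  obtain ⟨c, rfl⟩ := MulAction.exists_smul_eq G Q P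
  exact ⟨c * y * c⁻¹, Subgroup.smul_mem_pointwise_smul y (MulAut.conj c) (Q : Subgroup G)
    (hQ (Subgroup.mem_zpowers y)), isConj_iff.2 ⟨c, rfl⟩⟩

lemma card_sylow_mul_card_automizer_mul_card_centralizer [Finite G] (P : Sylow p G) :
    Nat.card (Sylow p G) * (Nat.card (automizer (P : Subgroup G)) *
      Nat.card (Subgroup.centralizer ((P : Subgroup G) : Set G))) = Nat.card G := by
  rw [card_automizer_mul_card_centralizer, P.card_eq_index_normalizer]
  exact Subgroup.index_mul_card _

lemma zpowers_eq_of_mem_of_card_eq_prime {P : Subgroup G} (hP : Nat.card P = p) {y : G}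
    (hy : y ∈ P) (hy1 : y ≠ 1) : Subgroup.zpowers y = P := by
  have : Finite P := Nat.finite_of_card_ne_zero (hP ▸ hp.out.ne_zero)
  have hle : Subgroup.zpowers y ≤ P := Subgroup.zpowers_le.2 hy
  have hdvd := Subgroup.card_dvd_of_le hle
  rw [hP, Nat.dvd_prime hp.out, Subgroup.card_eq_one, Subgroup.zpowers_eq_bot] at hdvd
  exact Subgroup.eq_of_le_of_card_ge hle (by rw [hP, hdvd.resolve_left hy1])

end Automizer

section SylowOfPrimeOrder

lemma card_subtype_ne_one {H : Type*} [Group H] [Finite H] :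
    Nat.card {x : H // x ≠ 1} = Nat.card H - 1 := by
  classical
  have := Fintype.ofFinite H
  rw [Nat.card_eq_fintype_card, Fintype.card_subtype_compl, Fintype.card_subtype_eq,
    ← Nat.card_eq_fintype_card]

lemma IsPElement.orderOf_eq_prime {G : Type*} [Group G] {p : ℕ} [hp : Fact p.Prime] {y : G}
    (hy : IsPElement p y) (hy1 : y ≠ 1) (hsq : ¬ p ^ 2 ∣ orderOf y) : orderOf y = p := by
  obtain ⟨k, hk⟩ := isPElement_iff_exists_orderOf_eq.1 hy
  match k with
  | 0 => exact absurd (orderOf_eq_one_iff.1 hk) hy1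
  | 1 => rwa [pow_one] at hk
  | k + 2 => exact absurd (hk ▸ pow_dvd_pow p (Nat.le_add_left 2 k)) hsq

variable {G : Type*} [Group G] [Finite G] {p : ℕ} [hp : Fact p.Prime]
  (hG : (Nat.card G).factorization p = 1)

include hG

lemma card_sylow_eq_prime (P : Sylow p G) : Nat.card (P : Subgroup G) = p := by
  rw [P.card_eq_multiplicity, hG, pow_one]

lemma not_sq_dvd_of_dvd_card {n : ℕ} (hn : n ∣ Nat.card G) : ¬ p ^ 2 ∣ n := by
  intro h
  have := (hp.out.pow_dvd_iff_le_factorization Nat.card_pos.ne').1 (h.trans hn)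
  omega

lemma exists_sylow_eq_iff_mem :
    ∃ f : {y : G // orderOf y = p} → Sylow p G, ∀ y P, f y = P ↔ y.1 ∈ P := by
  refine ⟨fun y => Sylow.ofCard (Subgroup.zpowers y.1) (by rw [Nat.card_zpowers, y.2, hG, pow_one]),
    fun y P => ⟨?_, fun hy => Sylow.ext ?_⟩⟩
  · rintro rfl
    exact Subgroup.mem_zpowers y.1
  · refine zpowers_eq_of_mem_of_card_eq_prime (card_sylow_eq_prime hG P) hy fun hy1 => ?_
    exact hp.out.one_lt.ne (by rw [← y.2, hy1, orderOf_one])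

lemma card_orderOf_eq_prime :
    Nat.card {y : G // orderOf y = p} = Nat.card (Sylow p G) * (p - 1) := by
  obtain ⟨f, hf⟩ := exists_sylow_eq_iff_mem hG
  refine card_eq_card_mul_of_card_fiber_eq f fun P => ?_
  have hP := card_sylow_eq_prime hG P
  have horder : ∀ x : (P : Subgroup G), x ≠ 1 → orderOf x.1 = p := fun x hx => by
    rw [Subgroup.orderOf_coe]
    have hdvd := orderOf_dvd_natCard x
    rw [hP] at hdvd
    exact orderOf_eq_prime (orderOf_dvd_iff_pow_eq_one.1 hdvd) hx
  have hcard : Nat.card {x : (P : Subgroup G) // x ≠ 1} = p - 1 := by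
    rw [card_subtype_ne_one, hP]
  rw [← hcard]
  refine Nat.card_congr ⟨fun y => ⟨⟨y.1.1, (hf y.1 P).1 y.2⟩, fun hy => ?_⟩,
    fun x => ⟨⟨x.1.1, horder x.1 x.2⟩, (hf _ P).2 x.1.2⟩, fun _ => rfl, fun _ => rfl⟩
  exact hp.out.one_lt.ne (by rw [← y.1.2, congrArg Subtype.val hy]; exact orderOf_one.symm)

lemma card_centralizer_singleton_eq (P : Sylow p G) {y : G} (hy : orderOf y = p) :
    Nat.card (Subgroup.centralizer ({y} : Set G)) =
      Nat.card (Subgroup.centralizer ((P : Subgroup G) : Set G)) := by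
  have hyp : IsPElement p y := isPElement_iff_exists_orderOf_eq.2 ⟨1, by rw [hy, pow_one]⟩
  obtain ⟨z, hz, hyz⟩ := hyp.exists_mem_sylow_isConj P
  have hz1 : z ≠ 1 := by
    rintro rfl
    rw [isConj_one_left] at hyz
    exact hp.out.one_lt.ne (by rw [← hy, hyz, orderOf_one])
  rw [card_centralizer_eq_of_isConj hyz,
    ← zpowers_eq_of_mem_of_card_eq_prime (card_sylow_eq_prime hG P) hz hz1,
    Subgroup.zpowers_eq_closure, Subgroup.centralizer_closure]

lemma prime_mul_card_pPart_fiber (P : Sylow p G) {y : G} (hy : orderOf y = p) :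
    p * Nat.card {g : G // pPart p g = y} =
      Nat.card (Subgroup.centralizer ((P : Subgroup G) : Set G)) := by
  set C := Subgroup.centralizer ({y} : Set G)
  set Z := Subgroup.zpowers (⟨y, Subgroup.mem_centralizer_singleton_iff.2 rfl⟩ : C)
  have hZ : Nat.card Z = p := by rw [Nat.card_zpowers, Subgroup.orderOf_mk, hy]
  have hindex : ¬ p ∣ Z.index := by
    intro h
    refine not_sq_dvd_of_dvd_card hG C.card_subgroup_dvd_card ?_
    rw [← Z.card_mul_index, hZ, pow_two]
    exact mul_dvd_mul_left p h
  have hcard := card_mul_card_pRegular_of_not_dvd_index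
    (IsPGroup.of_card (n := 1) (by rw [hZ, pow_one])) (zpowers_le_center_centralizer y) hindex
  have hyp : IsPElement p y := isPElement_iff_exists_orderOf_eq.2 ⟨1, by rw [hy, pow_one]⟩
  rw [card_pPart_fiber hyp, ← card_centralizer_singleton_eq hG P hy, ← hcard, hZ]

lemma prime_mul_card_dvd_orderOf (P : Sylow p G) :
    p * Nat.card {g : G // p ∣ orderOf g} = Nat.card {y : G // orderOf y = p} *
      Nat.card (Subgroup.centralizer ((P : Subgroup G) : Set G)) := by
  have horder : ∀ g : G, p ∣ orderOf g → orderOf (pPart p g) = p := fun g hg =>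
    (isPElement_pPart g).orderOf_eq_prime (fun h => pPart_eq_one_iff.1 h hg)
      (not_sq_dvd_of_dvd_card hG (orderOf_dvd_natCard _))
  obtain ⟨y₀, hy₀⟩ : ∃ y₀ : G, orderOf y₀ = p :=
    exists_prime_orderOf_dvd_card' p (Nat.dvd_of_factorization_pos (by omega))
  rw [← prime_mul_card_pPart_fiber hG P hy₀, mul_left_comm]
  congr 1
  refine card_eq_card_mul_of_card_fiber_eq (fun g : {g : G // p ∣ orderOf g} =>
    (⟨pPart p g.1, horder g.1 g.2⟩ : {y : G // orderOf y = p})) fun ⟨y, hy⟩ => ?_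
  have hdvd : ∀ g : G, pPart p g = y → p ∣ orderOf g := fun g hg => by
    by_contra hreg
    exact hp.out.one_lt.ne (by rw [← hy, ← hg, pPart_eq_one_iff.2 hreg, orderOf_one])
  refine Nat.eq_of_mul_eq_mul_left hp.out.pos (Eq.trans ?_
    ((prime_mul_card_pPart_fiber hG P hy).trans (prime_mul_card_pPart_fiber hG P hy₀).symm))
  congr 1
  exact Nat.card_congr ⟨fun g => ⟨g.1.1, congrArg Subtype.val g.2⟩,
    fun g => ⟨⟨g.1, hdvd g.1 g.2⟩, Subtype.ext g.2⟩, fun _ => rfl, fun _ => rfl⟩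

theorem factorization_rho_mul_card_automizer (P : Sylow p G) :
    (rho G).factorization p * (p * Nat.card (automizer (P : Subgroup G))) =
      Nat.card G * (p - 1) := by
  have hfiber := prime_mul_card_dvd_orderOf hG P
  rw [card_orderOf_eq_prime hG] at hfiber
  rw [factorization_rho_eq_card_of_not_sq_dvd fun g =>
    not_sq_dvd_of_dvd_card hG (orderOf_dvd_natCard g),
    ← card_sylow_mul_card_automizer_mul_card_centralizer P]
  linear_combination Nat.card (automizer (P : Subgroup G)) * hfiber

end SylowOfPrimeOrder

section Exponents

variable {G : Type*} [Group G] [Finite G]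

lemma factorization_rho_two_of_odd_mem {n : ℕ} (hn : Odd n) (h : n ∈ expRho G) :
    2 ∣ Nat.card G ∧ (rho G).factorization 2 = n := by
  rw [expRho_eq_image] at h
  obtain ⟨p, hp, rfl⟩ := Finset.mem_image.1 h
  obtain rfl : p = 2 := by
    by_contra hp2
    exact Nat.not_even_iff_odd.2 hn (even_factorization_rho hp2)
  exact ⟨Nat.dvd_of_mem_primeFactors hp, rfl⟩

theorem ordCompl_card_eq_of_mem_expRho {n : ℕ} (hodd : Odd n) (hsq : Squarefree n)
    (h : n ∈ expRho G) (hcard : n.primeFactors.card < (expRho G).card) :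
    ordCompl[2] (Nat.card G) = n := by
  obtain ⟨h2G, h2⟩ := factorization_rho_two_of_odd_mem hodd h
  set m := ordCompl[2] (Nat.card G) with hm
  have hmn : m ∣ n := h2 ▸ ordCompl_dvd_factorization_rho
  have hm' : m.primeFactors = (Nat.card G).primeFactors.erase 2 := by
    rw [hm, ← Nat.support_factorization, Nat.factorization_ordCompl, Finsupp.support_erase,
      Nat.support_factorization]
  have hle : n.primeFactors.card ≤ m.primeFactors.card := by
    rw [hm', Finset.card_erase_of_mem (Nat.mem_primeFactors.2
      ⟨Nat.prime_two, h2G, Nat.card_pos.ne'⟩)]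
    rw [expRho_eq_image] at hcard
    have := Finset.card_image_le (s := (Nat.card G).primeFactors) (f := (rho G).factorization)
    omega
  rw [← Nat.prod_primeFactors_of_squarefree hsq,
    ← Nat.prod_primeFactors_of_squarefree (hsq.squarefree_of_dvd hmn),
    Finset.eq_of_subset_of_card_le (Nat.primeFactors_mono hmn hsq.ne_zero) hle]

variable {q r : ℕ} [hq : Fact q.Prime] [hr : Fact r.Prime]

lemma factorization_rho_eq_of_expRho_eq (hq2 : q ≠ 2) (hr2 : r ≠ 2) (hqr : q ≠ r)
    (hqG : q ∣ Nat.card G) (hrG : r ∣ Nat.card G)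
    (h : expRho G = {q * r, 2 * r * (q - 1), 2 * q * (r - 1)}) :
    (rho G).factorization q = 2 * r * (q - 1) := by
  have hmem : (rho G).factorization q ∈ expRho G := by
    rw [expRho_eq_image]
    exact Finset.mem_image_of_mem _ (Nat.mem_primeFactors.2 ⟨hq.out, hqG, Nat.card_pos.ne'⟩)
  have heven : Even ((rho G).factorization q) := even_factorization_rho hq2
  have hdvd : r ∣ (rho G).factorization q := by
    refine dvd_trans ?_ ordCompl_dvd_factorization_rho
    rw [← Nat.ordProj_mul_ordCompl_eq_self (Nat.card G) q] at hrG
    exact (Nat.Coprime.pow_right _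
      ((Nat.coprime_primes hr.out hq.out).2 hqr.symm)).dvd_of_dvd_mul_left hrG
  simp only [h, Finset.mem_insert, Finset.mem_singleton] at hmem
  rcases hmem with h1 | h1 | h1
  · rw [h1, Nat.even_mul] at heven
    rcases heven with h2 | h2
    · exact absurd (hq.out.even_iff.1 h2) hq2
    · exact absurd (hr.out.even_iff.1 h2) hr2
  · exact h1
  · have hr1 : ¬ r ∣ r - 1 := fun hd =>
      (Nat.le_of_dvd (Nat.sub_pos_of_lt hr.out.one_lt) hd).not_gt
        (Nat.sub_lt hr.out.pos one_pos)
    rw [h1, hr.out.dvd_mul, hr.out.dvd_mul, Nat.prime_dvd_prime_iff_eq hr.out Nat.prime_two,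
      Nat.prime_dvd_prime_iff_eq hr.out hq.out] at hdvd
    tauto

lemma card_exponents_eq_three (hq2 : q ≠ 2) (hr2 : r ≠ 2) (hqr : q ≠ r) :
    ({q * r, 2 * r * (q - 1), 2 * q * (r - 1)} : Finset ℕ).card = 3 := by
  have hodd : Odd (q * r) := (hq.out.odd_of_ne_two hq2).mul (hr.out.odd_of_ne_two hr2)
  have hne : ∀ x, q * r ≠ 2 * x := fun x hx => Nat.not_even_iff_odd.2 hodd ⟨x, by rw [hx, two_mul]⟩
  refine Finset.card_eq_three.2
    ⟨_, _, _, mul_assoc 2 r _ ▸ hne _, mul_assoc 2 q _ ▸ hne _, fun h => hqr ?_, rfl⟩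
  have hq1 := hq.out.one_le
  have hr1 := hr.out.one_le
  zify [hq1, hr1] at h ⊢
  linarith

theorem ordCompl_card_eq_mul_of_expRho_eq (hq2 : q ≠ 2) (hr2 : r ≠ 2) (hqr : q ≠ r)
    (h : expRho G = {q * r, 2 * r * (q - 1), 2 * q * (r - 1)}) :
    ordCompl[2] (Nat.card G) = q * r := by
  have hcop : Nat.Coprime q r := (Nat.coprime_primes hq.out hr.out).2 hqr
  refine ordCompl_card_eq_of_mem_expRho
    ((hq.out.odd_of_ne_two hq2).mul (hr.out.odd_of_ne_two hr2))
    ((Nat.squarefree_mul hcop).2 ⟨hq.out.prime.squarefree, hr.out.prime.squarefree⟩)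
    (by rw [h]; exact Finset.mem_insert_self _ _) ?_
  rw [hcop.primeFactors_mul, hq.out.primeFactors, hr.out.primeFactors, h,
    card_exponents_eq_three hq2 hr2 hqr]
  exact Finset.card_le_two.trans_lt (by norm_num)

end Exponents

section Abelian

lemma factorization_rho_of_comm {G : Type*} [CommGroup G] [Finite G] {p m : ℕ}
    [hp : Fact p.Prime] (hm : ¬ p ∣ m) (hG : Nat.card G = p * m) :
    (rho G).factorization p = m * (p - 1) := by
  have hp1 : (Nat.card G).factorization p = 1 := by
    simpa only [hG, pow_one] using factorization_pow_mul_of_not_dvd 1 hm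
  obtain ⟨P⟩ : Nonempty (Sylow p G) := inferInstance
  have hP : Nat.card (automizer (P : Subgroup G)) = 1 :=
    card_automizer_eq_one_iff.2 fun x _ y _ => mul_comm y x
  have key := factorization_rho_mul_card_automizer hp1 P
  rw [hP, hG, mul_one] at key
  exact Nat.eq_of_mul_eq_mul_right hp.out.pos (by linarith)

theorem expRho_zmod {q r : ℕ} [hq : Fact q.Prime] [hr : Fact r.Prime] (hq2 : q ≠ 2) (hr2 : r ≠ 2)
    (hqr : q ≠ r) : expRho (Multiplicative (ZMod (2 * q * r))) =
      {q * r, 2 * r * (q - 1), 2 * q * (r - 1)} := by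
  have : NeZero (2 * q * r) := ⟨by have := hq.out.pos; have := hr.out.pos; positivity⟩
  have hcard : Nat.card (Multiplicative (ZMod (2 * q * r))) = 2 * q * r := by simp
  have hnd : ∀ a b c : ℕ, a.Prime → b.Prime → c.Prime → a ≠ b → a ≠ c → ¬ a ∣ b * c := by
    intro a b c ha hb hc hab hac h
    rw [ha.dvd_mul, Nat.prime_dvd_prime_iff_eq ha hb, Nat.prime_dvd_prime_iff_eq ha hc] at h
    tauto
  have hprimes : (2 * q * r).primeFactors = {2, q, r} := by
    rw [Nat.primeFactors_mul (mul_ne_zero two_ne_zero hq.out.ne_zero) hr.out.ne_zero,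
      Nat.primeFactors_mul two_ne_zero hq.out.ne_zero, Nat.prime_two.primeFactors,
      hq.out.primeFactors, hr.out.primeFactors, Finset.union_assoc]
    rfl
  rw [expRho_eq_image, hcard, hprimes, Finset.image_insert, Finset.image_insert,
    Finset.image_singleton,
    factorization_rho_of_comm (hnd 2 q r Nat.prime_two hq.out hr.out hq2.symm hr2.symm)
      (by rw [hcard, mul_assoc]),
    factorization_rho_of_comm (hnd q 2 r hq.out Nat.prime_two hr.out hq2 hqr)
      (by rw [hcard]; ring),
    factorization_rho_of_comm (hnd r 2 q hr.out Nat.prime_two hq.out hr2 hqr.symm)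
      (by rw [hcard]; ring)]
  simp only [Nat.reduceSub, mul_one]

end Abelian

section AutomizerBounds

variable {G : Type*} [Group G] [Finite G] {p : ℕ} [hp : Fact p.Prime] {P : Subgroup G}

lemma pow_eq_one_of_mem_automizer (h : ∀ y : G, IsPElement p y → y ^ p = 1)
    (hP : IsPGroup p (automizer P)) {φ : MulAut P} (hφ : φ ∈ automizer P) : φ ^ p = 1 := by
  obtain ⟨g, rfl⟩ := hφ
  set t := pPart p g
  have hreg : P.normalizerMonoidHom (t⁻¹ * g) = 1 := by
    obtain ⟨k, hk⟩ := hP ⟨P.normalizerMonoidHom (t⁻¹ * g), t⁻¹ * g, rfl⟩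
    rw [← orderOf_eq_one_iff]
    refine Nat.eq_one_of_dvd_coprimes (Nat.Coprime.pow_left k (hp.out.coprime_iff_not_dvd.2
      (pPart_inv_mul_mem_pRegular (p := p) g))) ?_ (orderOf_map_dvd _ _)
    exact orderOf_dvd_of_pow_eq_one (congrArg Subtype.val hk)
  have hpow : t ^ p = 1 := by
    obtain ⟨k, hk⟩ := isPElement_pPart (p := p) g
    exact Subtype.ext (h t ⟨k, congrArg Subtype.val hk⟩)
  rw [map_mul, map_inv, inv_mul_eq_one] at hreg
  rw [← hreg, ← map_pow, hpow, map_one]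

lemma card_automizer_dvd_prime (h : ∀ y : G, IsPElement p y → y ^ p = 1)
    (hP : IsPGroup p (automizer P)) (hcard : (Nat.card P).Prime) :
    Nat.card (automizer P) ∣ p := by
  have := Fact.mk hcard
  have : IsCyclic P := isCyclic_of_prime_card rfl
  have : IsCyclic (MulAut P) := (IsCyclic.mulAutMulEquiv P).isCyclic.2 inferInstance
  rw [← IsCyclic.exponent_eq_card]
  exact Monoid.exponent_dvd_of_forall_pow_eq_one fun φ =>
    Subtype.ext (pow_eq_one_of_mem_automizer h hP φ.2)

lemma not_dvd_card_automizer_sylow (P : Sylow p G) [IsMulCommutative (P : Subgroup G)] :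
    ¬ p ∣ Nat.card (automizer (P : Subgroup G)) := by
  intro hd
  have hC : Nat.card (P : Subgroup G) ∣
      Nat.card (Subgroup.centralizer ((P : Subgroup G) : Set G)) :=
    Subgroup.card_dvd_of_le (Subgroup.le_centralizer _)
  have hN := (mul_dvd_mul hd hC).trans
    ((card_automizer_mul_card_centralizer _).dvd.trans (Subgroup.card_subgroup_dvd_card _))
  rw [P.card_eq_multiplicity, ← pow_succ'] at hN
  exact Nat.pow_succ_factorization_not_dvd Nat.card_pos.ne' hp.out hN

end AutomizerBounds

section CyclicCase

variable {G : Type*} [Group G] [Finite G]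

open scoped commutatorElement in
lemma not_dvd_orderOf_commutator {p : ℕ} [Fact p.Prime] (P : Sylow p G)
    (hP : Subgroup.normalizer ((P : Subgroup G) : Set G) ≤
      Subgroup.centralizer ((P : Subgroup G) : Set G)) (g h : G) :
    ¬ p ∣ orderOf ⁅g, h⁆ := by
  intro hd
  refine MonoidHom.not_dvd_card_ker_transferSylow P hP
    (hd.trans (Subgroup.orderOf_dvd_natCard _ ?_))
  rw [MonoidHom.mem_ker, map_commutatorElement, commutatorElement_eq_one_iff_mul_comm]
  exact Subtype.ext (hP (Subgroup.le_normalizer (Subtype.prop _)) _ (Subtype.prop _))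

lemma mul_comm_of_forall_normalizer_le_centralizer
    (h : ∀ p : ℕ, p.Prime → p ∣ Nat.card G → ∀ P : Sylow p G,
      Subgroup.normalizer ((P : Subgroup G) : Set G) ≤
        Subgroup.centralizer ((P : Subgroup G) : Set G)) (a b : G) : a * b = b * a := by
  rw [← commutatorElement_eq_one_iff_mul_comm, ← orderOf_eq_one_iff]
  by_contra hne
  obtain ⟨p, hp, hd⟩ := Nat.exists_prime_and_dvd hne
  have := Fact.mk hp
  obtain ⟨P⟩ : Nonempty (Sylow p G) := inferInstance
  exact not_dvd_orderOf_commutator P (h p hp (hd.trans (orderOf_dvd_natCard _)) P) a b hd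

theorem isCyclic_of_squarefree_card_of_card_automizer_eq_one (hG : Squarefree (Nat.card G))
    (h : ∀ p : ℕ, p.Prime → p ∣ Nat.card G → p ≠ 2 → ∀ P : Sylow p G,
      Nat.card (automizer (P : Subgroup G)) = 1) : IsCyclic G := by
  have : IsZGroup G := IsZGroup.of_squarefree hG
  let _ : CommGroup G :=
    { mul_comm := mul_comm_of_forall_normalizer_le_centralizer fun p hp hd P => ?_ }
  · infer_instance
  · have := Fact.mk hp
    rcases eq_or_ne p 2 with rfl | hp2
    · exact IsCyclic.normalizer_le_centralizer (Nat.minFac_eq_two_iff _ |>.2 hd) inferInstance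
    · exact card_automizer_eq_one_iff.1 (h p hp hd hp2 P)

end CyclicCase

section Fusion

lemma card_mulAut_dvd_factorial (H : Type*) [Group H] [Finite H] :
    Nat.card (MulAut H) ∣ (Nat.card H - 1).factorial := by
  let f : MulAut H →* Equiv.Perm {x : H // x ≠ 1} :=
    { toFun := fun e => e.toEquiv.subtypeEquiv fun x => by simp
      map_one' := rfl
      map_mul' := fun _ _ => rfl }
  have hf : Function.Injective f := by
    intro e e' h
    ext x
    by_cases hx : x = 1
    · rw [hx, map_one, map_one]
    · exact congrArg Subtype.val (DFunLike.congr_fun h ⟨x, hx⟩)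
  have := Subgroup.card_dvd_of_injective f hf
  rwa [Nat.card_perm, card_subtype_ne_one] at this

variable {G : Type*} [Group G] [Finite G] {p : ℕ} [hp : Fact p.Prime] (h : HasUniquePClass p G)

include h

namespace HasUniquePClass

lemma exists_automizer_apply_eq (P : Sylow p G) [IsMulCommutative (P : Subgroup G)]
    {y z : (P : Subgroup G)} (hy : y ≠ 1) (hz : z ≠ 1) :
    ∃ φ ∈ automizer (P : Subgroup G), φ y = z := by
  have hP : ∀ x : (P : Subgroup G), x ≠ 1 → IsPElement p x.1 ∧ x.1 ≠ 1 := fun x hx =>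
    ⟨isPElement_of_mem_of_isPGroup P.isPGroup' x.2, mt (fun h => Subtype.ext h) hx⟩
  obtain ⟨g, hg⟩ := isConj_iff.1 (h (hP y hy).1 (hP z hz).1 (hP y hy).2 (hP z hz).2)
  obtain ⟨n, hn, hgn⟩ := P.conj_eq_normalizer_conj_of_mem y.1 g⁻¹ y.2
    (by rw [inv_inv, hg]; exact z.2)
  refine ⟨_, ⟨⟨n, hn⟩⁻¹, rfl⟩, Subtype.ext ?_⟩
  rw [← hg, ← inv_inv g, inv_inv g⁻¹, hgn]
  change n⁻¹ * y.1 * n⁻¹⁻¹ = _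
  rw [inv_inv]

theorem card_sub_one_dvd_card_automizer (P : Sylow p G) [IsMulCommutative (P : Subgroup G)]
    [Nontrivial (P : Subgroup G)] :
    Nat.card (P : Subgroup G) - 1 ∣ Nat.card (automizer (P : Subgroup G)) := by
  obtain ⟨y, hy⟩ := exists_ne (1 : (P : Subgroup G))
  have horbit : MulAction.orbit (automizer (P : Subgroup G)) y = {1}ᶜ := by
    ext z
    constructor
    · rintro ⟨φ, rfl⟩
      exact (map_ne_one_iff φ.1 φ.1.injective).2 hy
    · intro hz
      obtain ⟨φ, hφ, hφy⟩ := h.exists_automizer_apply_eq P hy hz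
      exact ⟨⟨φ, hφ⟩, hφy⟩
  have := (MulAction.stabilizer (automizer (P : Subgroup G)) y).index_dvd_card
  rwa [MulAction.index_stabilizer, horbit, Set.ncard_compl, Set.ncard_singleton] at this

lemma not_normal_of_dvd_card_automizer {R : Subgroup G} (hA : p ∣ Nat.card (automizer R))
    (hC : p ∣ Nat.card (Subgroup.centralizer (R : Set G))) : ¬ R.Normal := by
  intro hR
  obtain ⟨P⟩ : Nonempty (Sylow p G) := inferInstance
  have hP := mul_dvd_mul hA (Subgroup.card_dvd_of_le (h.sylow_le hC P))
  rw [card_automizer_mul_card_centralizer, R.normalizer_eq_top, Subgroup.card_top,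
    P.card_eq_multiplicity, ← pow_succ'] at hP
  exact Nat.pow_succ_factorization_not_dvd Nat.card_pos.ne' hp.out hP

theorem toPermHom_sylow_injective {P : Sylow p G}
    (hC : Subgroup.centralizer ((P : Subgroup G) : Set G) ≤ P) (hP : Nat.card (Sylow p G) ≠ 1) :
    Function.Injective (MulAction.toPermHom G (Sylow p G)) := by
  rw [← MonoidHom.ker_eq_bot_iff]
  set K := (MulAction.toPermHom G (Sylow p G)).ker
  have hfix : ∀ k ∈ K, ∀ Q : Sylow p G, k • Q = Q := fun k hk Q =>
    DFunLike.congr_fun (MonoidHom.mem_ker.1 hk) Q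
  have hdvd : ¬ p ∣ Nat.card K := by
    intro hd
    refine hP (Nat.card_eq_one_iff_unique.2 ⟨⟨fun Q Q' => ?_⟩, inferInstance⟩)
    have hQ : Q' ∈ MulAction.fixedPoints (Q : Subgroup G) (Sylow p G) := fun g =>
      hfix g.1 (h.sylow_le hd Q g.2) Q'
    exact Sylow.ext (Q.is_maximal' Q'.isPGroup' (Q.isPGroup'.sylow_mem_fixedPoints_iff.1 hQ)).symm
  have hdisj : Disjoint K (P : Subgroup G) := by
    refine Subgroup.disjoint_of_coprime_natCard (Nat.Coprime.symm ?_)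
    rw [P.card_eq_multiplicity]
    exact Nat.Coprime.pow_left _ (hp.out.coprime_iff_not_dvd.2 hdvd)
  have hKC : K ≤ Subgroup.centralizer ((P : Subgroup G) : Set G) := by
    intro k hk x hx
    have hkP : k ∈ Subgroup.normalizer ((P : Subgroup G) : Set G) :=
      Sylow.smul_eq_iff_mem_normalizer.1 (hfix k hk P)
    have hmem : x * (k * x⁻¹ * k⁻¹) ∈ K ⊓ (P : Subgroup G) := by
      refine ⟨?_, mul_mem hx ((Subgroup.mem_normalizer_iff.1 hkP _).1 (inv_mem hx))⟩
      rw [← mul_assoc, ← mul_assoc]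
      exact K.mul_mem ((MonoidHom.normal_ker _).conj_mem k hk x) (K.inv_mem hk)
    rw [hdisj.eq_bot, Subgroup.mem_bot] at hmem
    rw [← mul_inv_eq_one, ← hmem]
    group
  exact hdisj.eq_bot_of_le (hKC.trans hC)

end HasUniquePClass

end Fusion

section AlternatingCase

lemma nonempty_mulEquiv_alternatingGroup_of_injective {G X : Type*} [Group G] [Finite X]
    (f : G →* Equiv.Perm X) (hf : Function.Injective f)
    (hG : 2 * Nat.card G = (Nat.card X).factorial) :
    Nonempty (G ≃* alternatingGroup (Fin (Nat.card X))) := by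
  classical
  have := Fintype.ofFinite X
  have hindex : f.range.index = 2 := by
    have hcard := f.range.index_mul_card
    rw [← Nat.card_congr (MonoidHom.ofInjective hf).toEquiv, Nat.card_perm, ← hG] at hcard
    have : 0 < Nat.card G := Nat.pos_of_mul_pos_left (hG ▸ Nat.factorial_pos _)
    exact Nat.eq_of_mul_eq_mul_right this hcard
  exact ⟨(MonoidHom.ofInjective hf).trans ((MulEquiv.subgroupCongr
    (Equiv.Perm.eq_alternatingGroup_of_index_eq_two hindex)).trans
      (Equiv.altCongrHom (Finite.equivFin X)))⟩

variable {G : Type*} [Group G] [Finite G]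

lemma not_dvd_card_centralizer_of_card_centralizer_sylow_eq {p : ℕ} [hp : Fact p.Prime]
    (hG : (Nat.card G).factorization p = 1) (R : Sylow p G)
    (hR : Nat.card (Subgroup.centralizer ((R : Subgroup G) : Set G)) = p) {H : Subgroup G}
    (hH : ¬ Nat.card H ∣ p) : ¬ p ∣ Nat.card (Subgroup.centralizer (H : Set G)) := by
  intro hd
  obtain ⟨⟨y, hyC⟩, hy⟩ := exists_prime_orderOf_dvd_card' p hd
  rw [Subgroup.orderOf_mk] at hy
  have hle : H ≤ Subgroup.centralizer ({y} : Set G) := fun x hx =>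
    Subgroup.mem_centralizer_singleton_iff.2 (hyC x hx)
  have hdvd := Subgroup.card_dvd_of_le hle
  rw [card_centralizer_singleton_eq hG R hy, hR] at hdvd
  exact hH hdvd

namespace HasUniquePClass

variable (h : HasUniquePClass 2 G)

include h

lemma card_automizer_sylow_two_eq_three (hG : (Nat.card G).factorization 2 = 2)
    (P : Sylow 2 G) : Nat.card (automizer (P : Subgroup G)) = 3 := by
  have hP : Nat.card (P : Subgroup G) = 2 ^ 2 := by rw [P.card_eq_multiplicity, hG]
  have : IsMulCommutative (P : Subgroup G) := IsPGroup.isMulCommutative_of_card_eq_prime_sq hP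
  have : Nontrivial (P : Subgroup G) := Finite.one_lt_card_iff_nontrivial.1 (by rw [hP]; norm_num)
  have h3 : 3 ∣ Nat.card (automizer (P : Subgroup G)) := by
    have := h.card_sub_one_dvd_card_automizer P
    rwa [hP] at this
  have h6 : Nat.card (automizer (P : Subgroup G)) ∣ 3 * 2 := by
    have := card_mulAut_dvd_factorial (P : Subgroup G)
    rw [hP] at this
    exact (Subgroup.card_subgroup_dvd_card _).trans this
  have h2 := not_dvd_card_automizer_sylow P
  obtain ⟨k, hk⟩ := h3
  rw [hk] at h6 h2 ⊢
  rcases (Nat.dvd_prime Nat.prime_two).1 (Nat.dvd_of_mul_dvd_mul_left three_pos h6) with rfl | rfl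
  · rfl
  · exact absurd (dvd_mul_left 2 3) h2

section AutomizerOfOrderTwo

variable {p : ℕ} [hp : Fact p.Prime] (R : Sylow p G)
  (hR : Nat.card (automizer (R : Subgroup G)) = 2)

include hR

lemma card_sylow_ne_one (hG : 2 ^ 2 ∣ Nat.card G) : Nat.card (Sylow p G) ≠ 1 := by
  intro h1
  have := (Nat.card_eq_one_iff_unique.1 h1).1
  have hcard := card_sylow_mul_card_automizer_mul_card_centralizer R
  rw [h1, one_mul, hR] at hcard
  rw [← hcard, pow_two] at hG
  exact h.not_normal_of_dvd_card_automizer hR.symm.dvd (Nat.dvd_of_mul_dvd_mul_left two_pos hG)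
    R.normal_of_subsingleton

lemma eq_five_and_card_centralizer_eq (hp3 : 3 < p) (hG : Nat.card G = 2 ^ 2 * 3 * p) :
    p = 5 ∧ Nat.card (Subgroup.centralizer ((R : Subgroup G) : Set G)) = p := by
  have hp12 : ¬ p ∣ 2 ^ 2 * 3 := fun hd => (hp.out.dvd_mul.1 hd).elim
    (fun h2 => (Nat.le_of_dvd two_pos (hp.out.dvd_of_dvd_pow h2)).not_gt (by omega))
    fun h3 => (Nat.le_of_dvd three_pos h3).not_gt hp3
  have hG1 : (Nat.card G).factorization p = 1 := by
    simpa only [hG, pow_one, mul_comm p] using factorization_pow_mul_of_not_dvd 1 hp12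
  have := isCyclic_of_prime_card (card_sylow_eq_prime hG1 R)
  obtain ⟨c, hc⟩ : p ∣ Nat.card (Subgroup.centralizer ((R : Subgroup G) : Set G)) := by
    have := Subgroup.card_dvd_of_le (Subgroup.le_centralizer (R : Subgroup G))
    rwa [card_sylow_eq_prime hG1 R] at this
  have hcard := card_sylow_mul_card_automizer_mul_card_centralizer R
  rw [hR, hc, hG] at hcard
  have hsix : Nat.card (Sylow p G) * c = 6 :=
    Nat.eq_of_mul_eq_mul_left (Nat.mul_pos two_pos hp.out.pos) (by linarith)
  have hne := h.card_sylow_ne_one R hR (hG ▸ ⟨3 * p, by ring⟩)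
  have hlt : p + 1 ≤ Nat.card (Sylow p G) := by
    have hpos : 1 ≤ Nat.card (Sylow p G) := Nat.card_pos
    have hdvd := (Nat.modEq_iff_dvd' hpos).1 (card_sylow_modEq_one p G).symm
    have := Nat.le_of_dvd (by omega) hdvd
    omega
  have hc1 : c = 1 := by
    have : 0 < c := Nat.pos_of_ne_zero (by rintro rfl; omega)
    nlinarith
  have hp4 : p ≠ 4 := by
    rintro rfl
    exact absurd hp.out (by decide)
  rw [hc, hc1, mul_one]
  rw [hc1] at hsix
  omega

end AutomizerOfOrderTwo

variable (hG : Nat.card G = 60) (R : Sylow 5 G)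
  (hR : Nat.card (Subgroup.centralizer ((R : Subgroup G) : Set G)) = 5)

include hG hR

lemma card_sylow_two_eq_five_and_centralizer_le (P : Sylow 2 G) :
    Nat.card (Sylow 2 G) = 5 ∧ Subgroup.centralizer ((P : Subgroup G) : Set G) ≤ P := by
  have := Fact.mk Nat.prime_five
  have h2 : (Nat.card G).factorization 2 = 2 := by
    rw [hG]
    exact factorization_pow_mul_of_not_dvd (p := 2) (m := 15) 2 (by norm_num)
  have h5 : (Nat.card G).factorization 5 = 1 := by
    rw [hG]
    exact factorization_pow_mul_of_not_dvd (p := 5) (m := 12) 1 (by norm_num)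
  have hP : Nat.card (P : Subgroup G) = 2 ^ 2 := by rw [P.card_eq_multiplicity, h2]
  have : IsMulCommutative (P : Subgroup G) := IsPGroup.isMulCommutative_of_card_eq_prime_sq hP
  have hC5 := not_dvd_card_centralizer_of_card_centralizer_sylow_eq h5 R hR (H := P)
    (by rw [hP]; norm_num)
  obtain ⟨k, hk⟩ := Subgroup.card_dvd_of_le (Subgroup.le_centralizer (P : Subgroup G))
  have hcard := card_sylow_mul_card_automizer_mul_card_centralizer P
  rw [h.card_automizer_sylow_two_eq_three h2 P, hG, hk, hP] at hcard
  have hk1 : k = 1 := by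
    have hdvd : k ∣ 5 := ⟨Nat.card (Sylow 2 G), by linarith⟩
    refine ((Nat.dvd_prime Nat.prime_five).1 hdvd).resolve_right fun hk5 => hC5 ?_
    rw [hk, hk5]
    exact dvd_mul_left _ _
  rw [hk1, mul_one] at hk hcard
  exact ⟨by omega, (Subgroup.eq_of_le_of_card_ge (Subgroup.le_centralizer (P : Subgroup G))
    (by rw [hk, hP])).ge⟩

theorem nonempty_mulEquiv_alternatingGroup : Nonempty (G ≃* alternatingGroup (Fin 5)) := by
  obtain ⟨P⟩ : Nonempty (Sylow 2 G) := inferInstance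
  obtain ⟨hn, hP⟩ := h.card_sylow_two_eq_five_and_centralizer_le hG R hR P
  rw [← hn]
  exact nonempty_mulEquiv_alternatingGroup_of_injective _
    (h.toPermHom_sylow_injective hP (by omega)) (by rw [hG, hn]; rfl)

end HasUniquePClass

end AlternatingCase

section Converse

lemma exponents_comm (q r : ℕ) : ({q * r, 2 * r * (q - 1), 2 * q * (r - 1)} : Finset ℕ) =
    {r * q, 2 * q * (r - 1), 2 * r * (q - 1)} := by
  rw [mul_comm q r, Finset.pair_comm]

variable {G : Type*} [Group G] [Finite G] {q r : ℕ} [hq : Fact q.Prime] [hr : Fact r.Prime]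
  (hq2 : q ≠ 2) (hr2 : r ≠ 2) (hqr : q ≠ r)
  (h : expRho G = {q * r, 2 * r * (q - 1), 2 * q * (r - 1)})

include hq2 hr2 h

lemma two_dvd_card_and_factorization_rho_two_of_expRho_eq :
    2 ∣ Nat.card G ∧ (rho G).factorization 2 = q * r :=
  factorization_rho_two_of_odd_mem
    ((hq.out.odd_of_ne_two hq2).mul (hr.out.odd_of_ne_two hr2))
    (by rw [h]; exact Finset.mem_insert_self _ _)

include hqr

lemma card_eq_of_expRho_eq : Nat.card G = ordProj[2] (Nat.card G) * (q * r) := by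
  rw [← ordCompl_card_eq_mul_of_expRho_eq hq2 hr2 hqr h, Nat.ordProj_mul_ordCompl_eq_self]

lemma hasUniquePClass_two_of_expRho_eq : HasUniquePClass 2 G :=
  hasUniquePClass_of_factorization_rho_eq <| by
    rw [(two_dvd_card_and_factorization_rho_two_of_expRho_eq hq2 hr2 h).2,
      ordCompl_card_eq_mul_of_expRho_eq hq2 hr2 hqr h]

lemma factorization_card_eq_one_of_expRho_eq : (Nat.card G).factorization q = 1 := by
  have hnd : ¬ q ∣ ordProj[2] (Nat.card G) * r := fun hd => (hq.out.dvd_mul.1 hd).elim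
    (fun hd2 => hq2 ((Nat.prime_dvd_prime_iff_eq hq.out Nat.prime_two).1
      (hq.out.dvd_of_dvd_pow hd2)))
    fun hdr => hqr ((Nat.prime_dvd_prime_iff_eq hq.out hr.out).1 hdr)
  rw [card_eq_of_expRho_eq hq2 hr2 hqr h, mul_left_comm]
  simpa only [pow_one] using factorization_pow_mul_of_not_dvd 1 hnd

lemma two_mul_card_automizer_of_expRho_eq (Q : Sylow q G) :
    2 * Nat.card (automizer (Q : Subgroup G)) = ordProj[2] (Nat.card G) := by
  have hG := card_eq_of_expRho_eq hq2 hr2 hqr h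
  have hq1 : 0 < q - 1 := Nat.sub_pos_of_lt hq.out.one_lt
  have key := factorization_rho_mul_card_automizer
    (factorization_card_eq_one_of_expRho_eq hq2 hr2 hqr h) Q
  rw [factorization_rho_eq_of_expRho_eq hq2 hr2 hqr 
    (((dvd_mul_right q r).mul_left _).trans hG.symm.dvd)
    (((dvd_mul_left r q).mul_left _).trans hG.symm.dvd) h] at key
  refine Nat.eq_of_mul_eq_mul_right (Nat.mul_pos (Nat.mul_pos hq.out.pos hr.out.pos) hq1) ?_
  linear_combination key + (q - 1) * hG

lemma card_automizer_dvd_two_of_expRho_eq (Q : Sylow q G) :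
    Nat.card (automizer (Q : Subgroup G)) ∣ 2 := by
  refine card_automizer_dvd_prime
    (fun y hy => (hasUniquePClass_two_of_expRho_eq hq2 hr2 hqr h).pow_eq_one hy) ?_ ?_
  · have hA := two_mul_card_automizer_of_expRho_eq hq2 hr2 hqr h Q
    obtain ⟨k, -, hk⟩ := (Nat.dvd_prime_pow Nat.prime_two).1 (hA ▸ dvd_mul_left _ 2)
    exact IsPGroup.of_card hk
  · rw [card_sylow_eq_prime (factorization_card_eq_one_of_expRho_eq hq2 hr2 hqr h) Q]
    exact hq.out

lemma isCyclic_of_expRho_eq (hG : Nat.card G = 2 * q * r) : IsCyclic G := by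
  have hproj : ordProj[2] (Nat.card G) = 2 := by
    refine Nat.eq_of_mul_eq_mul_right (Nat.mul_pos hq.out.pos hr.out.pos) ?_
    rw [← card_eq_of_expRho_eq hq2 hr2 hqr h, hG, mul_assoc]
  have hsq : Squarefree (2 * q * r) := by
    rw [Nat.squarefree_mul (Nat.Coprime.mul_left ((Nat.coprime_primes Nat.prime_two hr.out).2
      hr2.symm) ((Nat.coprime_primes hq.out hr.out).2 hqr)),
      Nat.squarefree_mul ((Nat.coprime_primes Nat.prime_two hq.out).2 hq2.symm)]
    exact ⟨⟨Nat.prime_two.prime.squarefree, hq.out.prime.squarefree⟩, hr.out.prime.squarefree⟩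
  refine isCyclic_of_squarefree_card_of_card_automizer_eq_one (hG ▸ hsq) fun p hp hpG hp2 P => ?_
  rw [hG, hp.dvd_mul, hp.dvd_mul, Nat.prime_dvd_prime_iff_eq hp Nat.prime_two,
    Nat.prime_dvd_prime_iff_eq hp hq.out, Nat.prime_dvd_prime_iff_eq hp hr.out] at hpG
  have hA : 2 * Nat.card (automizer (P : Subgroup G)) = 2 := by
    rcases hpG with (rfl | rfl) | rfl
    · exact absurd rfl hp2
    · exact (two_mul_card_automizer_of_expRho_eq hq2 hr2 hqr h P).trans hproj
    · exact (two_mul_card_automizer_of_expRho_eq hr2 hq2 hqr.symm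
        (h.trans (exponents_comm q p)) P).trans hproj
  omega

lemma three_dvd_of_expRho_eq (hG : Nat.card G = 2 ^ 2 * (q * r)) : 3 ∣ q * r := by
  have h2 : (Nat.card G).factorization 2 = 2 := by
    rw [hG]
    exact factorization_pow_mul_of_not_dvd 2
      ((hq.out.odd_of_ne_two hq2).mul (hr.out.odd_of_ne_two hr2)).not_two_dvd_nat
  obtain ⟨P⟩ : Nonempty (Sylow 2 G) := inferInstance
  have h3G : 3 ∣ Nat.card G := by
    have hcard := card_sylow_mul_card_automizer_mul_card_centralizer P
    rw [(hasUniquePClass_two_of_expRho_eq hq2 hr2 hqr h).card_automizer_sylow_two_eq_three h2 P]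
      at hcard
    exact hcard ▸ (dvd_mul_right 3 _).mul_left _
  rw [hG] at h3G
  exact (Nat.Coprime.pow_right 2 (by norm_num)).dvd_of_dvd_mul_left h3G

omit hq hq2 hqr h

lemma eq_five_and_nonempty_mulEquiv_alternatingGroup_of_expRho_eq (hr3 : r ≠ 3)
    (h : expRho G = {r * 3, 2 * 3 * (r - 1), 2 * r * (3 - 1)})
    (hG : Nat.card G = 2 ^ 2 * (r * 3)) :
    r = 5 ∧ Nonempty (G ≃* alternatingGroup (Fin 5)) := by
  have h32 : 3 ≠ 2 := by norm_num
  have hrgt : 3 < r := by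
    have := hr.out.two_le
    omega
  have hclass := hasUniquePClass_two_of_expRho_eq hr2 h32 hr3 h
  obtain ⟨R⟩ : Nonempty (Sylow r G) := inferInstance
  have hA : Nat.card (automizer (R : Subgroup G)) = 2 := by
    refine Nat.eq_of_mul_eq_mul_left two_pos
      ((two_mul_card_automizer_of_expRho_eq hr2 h32 hr3 h R).trans ?_)
    refine Nat.eq_of_mul_eq_mul_right (Nat.mul_pos hr.out.pos three_pos) ?_
    rw [← card_eq_of_expRho_eq hr2 h32 hr3 h, hG]
    rfl
  obtain ⟨rfl, hC⟩ := hclass.eq_five_and_card_centralizer_eq R hA hrgt (by rw [hG]; ring)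
  exact ⟨rfl, hclass.nonempty_mulEquiv_alternatingGroup hG R hC⟩

include hq hq2 hqr h

theorem nonempty_mulEquiv_of_expRho_eq :
    (({q, r} : Set ℕ) = {3, 5} ∧ Nonempty (G ≃* alternatingGroup (Fin 5))) ∨
      Nonempty (G ≃* Multiplicative (ZMod (2 * q * r))) := by
  have hG := card_eq_of_expRho_eq hq2 hr2 hqr h
  obtain ⟨Q⟩ : Nonempty (Sylow q G) := inferInstance
  rw [← two_mul_card_automizer_of_expRho_eq hq2 hr2 hqr h Q] at hG
  rcases (Nat.dvd_prime Nat.prime_two).1 (card_automizer_dvd_two_of_expRho_eq hq2 hr2 hqr h Q)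
    with hA | hA <;> rw [hA] at hG
  · have hcard : Nat.card G = 2 * q * r := by rw [hG]; ring
    have := isCyclic_of_expRho_eq hq2 hr2 hqr h hcard
    exact .inr ⟨mulEquivOfCyclicCardEq (by simpa using hcard)⟩
  · have h3 := three_dvd_of_expRho_eq hq2 hr2 hqr h hG
    rw [Nat.prime_three.dvd_mul, Nat.prime_dvd_prime_iff_eq Nat.prime_three hq.out,
      Nat.prime_dvd_prime_iff_eq Nat.prime_three hr.out] at h3
    left
    rcases h3 with rfl | rfl
    · obtain ⟨rfl, hiso⟩ := eq_five_and_nonempty_mulEquiv_alternatingGroup_of_expRho_eq hr2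
        hqr.symm (h.trans (exponents_comm 3 r)) (by rw [hG]; ring)
      exact ⟨rfl, hiso⟩
    · obtain ⟨rfl, hiso⟩ := eq_five_and_nonempty_mulEquiv_alternatingGroup_of_expRho_eq hq2
        hqr h hG
      exact ⟨Set.pair_comm 5 3, hiso⟩

end Converse

section SL

open Matrix SpecialLinearGroup

variable {R : Type*} [CommRing R]

lemma mem_center_of_eq_smul_one {n : Type*} [Fintype n] [DecidableEq n]
    {A : SpecialLinearGroup n R} {c : R} (hA : (A : Matrix n n R) = c • (1 : Matrix n n R)) :
    A ∈ Subgroup.center (SpecialLinearGroup n R) := by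
  refine mem_center_iff.2 ⟨c, ?_, ?_⟩
  · rw [← A.det_coe, hA, det_smul, det_one, mul_one]
  · rw [hA, smul_one_eq_diagonal, scalar_apply]

lemma mem_center_SL_two_iff [IsDomain R] {A : SpecialLinearGroup (Fin 2) R} :
    A ∈ Subgroup.center (SpecialLinearGroup (Fin 2) R) ↔ A = 1 ∨ A = -1 := by
  constructor
  · intro hA
    obtain ⟨c, hc, hcA⟩ := mem_center_iff.1 hA
    rw [Fintype.card_fin, sq_eq_one_iff] at hc
    rcases hc with rfl | rfl
    · exact .inl (Subtype.ext (hcA.symm.trans (map_one _)))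
    · exact .inr (Subtype.ext (hcA.symm.trans (by rw [map_neg, map_one]; rfl)))
  · rintro (rfl | rfl)
    · exact one_mem _
    · exact mem_center_of_eq_smul_one (c := -1) (by simp)

lemma card_center_SL_two [IsDomain R] (h2 : (2 : R) ≠ 0) :
    Nat.card (Subgroup.center (SpecialLinearGroup (Fin 2) R)) = 2 := by
  have hcenter : (Subgroup.center (SpecialLinearGroup (Fin 2) R) :
      Set (SpecialLinearGroup (Fin 2) R)) = {1, -1} := Set.ext fun _ => mem_center_SL_two_iff
  have hne : (1 : SpecialLinearGroup (Fin 2) R) ≠ -1 := by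
    intro h
    have h00 : (1 : R) = -1 := by
      simpa using congrArg (fun A : SpecialLinearGroup (Fin 2) R => A 0 0) h
    exact h2 (by linear_combination h00)
  exact (congrArg Set.ncard hcenter).trans (Set.ncard_pair hne)

end SL

section TwoByTwo

open Matrix

variable {R : Type*} [CommRing R] {A : Matrix (Fin 2) (Fin 2) R} (hA : A.det = 1)

include hA

lemma sq_eq_of_det_eq_one : A ^ 2 = A.trace • A - 1 := by
  nontriviality R
  have h := aeval_self_charpoly A
  simp only [charpoly_fin_two, hA, map_add, map_sub, map_mul, map_pow, Polynomial.aeval_X,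
    Polynomial.aeval_C, map_one] at h
  rw [Algebra.smul_def, eq_sub_iff_add_eq, ← sub_eq_zero, ← h]
  abel

lemma pow_three_eq_of_det_eq_one : A ^ 3 = (A.trace ^ 2 - 1) • A - A.trace • 1 := by
  rw [pow_succ', sq_eq_of_det_eq_one hA, mul_sub, mul_smul_comm, mul_one, ← pow_two,
    sq_eq_of_det_eq_one hA]
  module

lemma pow_five_eq_of_det_eq_one : A ^ 5 =
    (A.trace ^ 4 - 3 * A.trace ^ 2 + 1) • A - (A.trace ^ 3 - 2 * A.trace) • 1 := by
  rw [pow_add _ 3 2, pow_three_eq_of_det_eq_one hA, sub_mul, smul_mul_assoc, smul_mul_assoc,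
    one_mul, ← pow_succ', pow_three_eq_of_det_eq_one hA, sq_eq_of_det_eq_one hA]
  module

end TwoByTwo

section PSL

open Matrix

/-- The order of the image in `PSL(2, 5)` of a matrix of determinant `1`, read off from its
trace. -/
def projectiveOrder (A : SpecialLinearGroup (Fin 2) (ZMod 5)) : ℕ :=
  if A = 1 ∨ A = -1 then 1
  else if (A : Matrix (Fin 2) (Fin 2) (ZMod 5)).trace = 0 then 2
  else if (A : Matrix (Fin 2) (Fin 2) (ZMod 5)).trace ^ 2 = 1 then 3
  else 5

lemma orderOf_mk_PSL_two_five (A : SpecialLinearGroup (Fin 2) (ZMod 5)) :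
    orderOf (A : ProjectiveSpecialLinearGroup (Fin 2) (ZMod 5)) = projectiveOrder A := by
  have htrace : ∀ t : ZMod 5, t ≠ 0 → t ^ 2 ≠ 1 → t ^ 4 - 3 * t ^ 2 + 1 = 0 := by decide
  have := Fact.mk Nat.prime_five
  have hone : (A : ProjectiveSpecialLinearGroup (Fin 2) (ZMod 5)) = 1 ↔ A = 1 ∨ A = -1 :=
    (QuotientGroup.eq_one_iff A).trans mem_center_SL_two_iff
  have hpow (n : ℕ) (c d : ZMod 5)
      (hn : (A : Matrix (Fin 2) (Fin 2) (ZMod 5)) ^ n =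
        c • (A : Matrix (Fin 2) (Fin 2) (ZMod 5)) - d • 1) (hc : c = 0) :
      (A : ProjectiveSpecialLinearGroup (Fin 2) (ZMod 5)) ^ n = 1 := by
    refine (QuotientGroup.eq_one_iff (A ^ n)).2 (mem_center_of_eq_smul_one (c := -d) ?_)
    rw [Matrix.SpecialLinearGroup.coe_pow, hn, hc, zero_smul, zero_sub, neg_smul]
  rw [projectiveOrder]
  split_ifs with h1 h2 h3
  · rw [hone.2 h1, orderOf_one]
  · refine orderOf_eq_prime (hpow 2 _ 1 ?_ h2) (mt hone.1 h1)
    rw [sq_eq_of_det_eq_one A.det_coe, one_smul]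
  · exact orderOf_eq_prime (hpow 3 _ _ (pow_three_eq_of_det_eq_one A.det_coe)
      (sub_eq_zero.2 h3)) (mt hone.1 h1)
  · exact orderOf_eq_prime (hpow 5 _ _ (pow_five_eq_of_det_eq_one A.det_coe)
      (htrace _ h2 h3)) (mt hone.1 h1)

lemma prod_projectiveOrder :
    ∏ A : SpecialLinearGroup (Fin 2) (ZMod 5), projectiveOrder A =
      (2 ^ 15 * 3 ^ 20 * 5 ^ 24) ^ 2 := by
  decide +kernel

lemma rho_PSL_two_five : rho (ProjectiveSpecialLinearGroup (Fin 2) (ZMod 5)) =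
    2 ^ 15 * 3 ^ 20 * 5 ^ 24 := by
  have := Fact.mk Nat.prime_five
  have hsq : rho (ProjectiveSpecialLinearGroup (Fin 2) (ZMod 5)) ^ 2 =
      (2 ^ 15 * 3 ^ 20 * 5 ^ 24) ^ 2 := by
    have hprod := prod_orderOf_quotient_mk
      (Subgroup.center (SpecialLinearGroup (Fin 2) (ZMod 5)))
    rw [card_center_SL_two (by decide)] at hprod
    rw [← prod_projectiveOrder]
    exact hprod.symm.trans (Finset.prod_congr rfl fun A _ => orderOf_mk_PSL_two_five A)
  exact Nat.pow_left_injective two_ne_zero hsq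

lemma expRho_PSL_two_five :
    expRho (ProjectiveSpecialLinearGroup (Fin 2) (ZMod 5)) = {15, 20, 24} := by
  have h2 : (2 ^ 15 : ℕ) ≠ 0 := by norm_num
  have h3 : (3 ^ 20 : ℕ) ≠ 0 := by norm_num
  have h5 : (5 ^ 24 : ℕ) ≠ 0 := by norm_num
  rw [expRho, expSet, rho_PSL_two_five, Nat.primeFactors_mul (mul_ne_zero h2 h3) h5,
    Nat.primeFactors_mul h2 h3, Nat.primeFactors_prime_pow (by norm_num) Nat.prime_two,
    Nat.primeFactors_prime_pow (by norm_num) Nat.prime_three,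
    Nat.primeFactors_prime_pow (by norm_num) Nat.prime_five,
    Nat.factorization_mul (mul_ne_zero h2 h3) h5, Nat.factorization_mul h2 h3,
    Nat.prime_two.factorization_pow, Nat.prime_three.factorization_pow,
    Nat.prime_five.factorization_pow]
  simp

theorem nonempty_PSL_two_five_mulEquiv_alternatingGroup :
    Nonempty (ProjectiveSpecialLinearGroup (Fin 2) (ZMod 5) ≃* alternatingGroup (Fin 5)) := by
  have := Fact.mk Nat.prime_five
  refine ((nonempty_mulEquiv_of_expRho_eq (q := 3) (r := 5) (by norm_num) (by norm_num)
    (by norm_num) expRho_PSL_two_five).resolve_right ?_).2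
  rintro ⟨e⟩
  obtain ⟨A, hA⟩ := QuotientGroup.mk_surjective (e.symm (Multiplicative.ofAdd 1))
  have horder := orderOf_mk_PSL_two_five A
  rw [hA, e.symm.orderOf_eq, orderOf_ofAdd_eq_addOrderOf, ZMod.addOrderOf_one,
    projectiveOrder] at horder
  split_ifs at horder <;> omega

end PSL

theorem mainTheorem2 {G : Type*} [Group G] [Finite G] (q r : ℕ)
    (hq : q.Prime) (hr : r.Prime) (hq2 : Odd q) (hr2 : Odd r) (hqr : q ≠ r) :
    expRho (Multiplicative (ZMod (2 * q * r))) = {q * r, 2 * r * (q - 1), 2 * q * (r - 1)} ∧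
    (((({q, r} : Set ℕ) = {3, 5} ∧
          Nonempty (G ≃* Matrix.ProjectiveSpecialLinearGroup (Fin 2) (ZMod 5))) ∨
        Nonempty (G ≃* Multiplicative (ZMod (2 * q * r)))) ↔
      expRho G = expRho (Multiplicative (ZMod (2 * q * r)))) := by
  have := Fact.mk hq
  have := Fact.mk hr
  have hq2' : q ≠ 2 := hq2.ne_two_of_dvd_nat dvd_rfl
  have hr2' : r ≠ 2 := hr2.ne_two_of_dvd_nat dvd_rfl
  have hZ := expRho_zmod hq2' hr2' hqr
  obtain ⟨ePSL⟩ := nonempty_PSL_two_five_mulEquiv_alternatingGroup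
  refine ⟨hZ, ?_, fun h => ?_⟩
  · rintro (⟨hset, ⟨e⟩⟩ | ⟨⟨e⟩⟩)
    · rw [hZ, expRho, rho_congr e, ← expRho, expRho_PSL_two_five]
      rcases Set.pair_eq_pair_iff.1 hset with ⟨rfl, rfl⟩ | ⟨rfl, rfl⟩ <;> decide
    · rw [expRho, rho_congr e, ← expRho]
  · exact (nonempty_mulEquiv_of_expRho_eq hq2' hr2' hqr (h.trans hZ)).imp_left fun ⟨hset, ⟨e⟩⟩ =>
      ⟨hset, ⟨e.trans ePSL.symm⟩⟩
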